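/- Let $F$ be a field of characteristic zero and let $L$ be a finite-dimensional Lie algebra over $F$. Let $\mathcal{L}_{\mathrm{id}}(L)$ be the lattice of ideals of $L$ (ordered by inclusion, with join $I+J$ and meet $I\cap J$), and let $Z(L)$ be the centre of $L$. A Lie algebra is called semisimple if its solvable radical is zero (so $0$ is semisimple); its simple components are its simple ideals, simple Lie algebras being non-abelian. The Jacobson radical of $L$ is the intersection of all maximal ideals of $L$ (equal to $L$ if there are none). A bounded lattice is complemented if every element $a$ has a complement $b$ (that is, $a\vee b=1$ and $a\wedge b=0$), and Boolean if it is complemented and distributive. The $n$-cube is the lattice of subsets of $\{1,\dots,n\}$. 1. $\mathcal{L}_{\mathrm{id}}(L)$ is complemented if and only if $L=S\oplus A$ for some semisimple ideal $S$ and some abelian ideal $A$ of $L$. In every such decomposition $A=Z(L)$. 2. The following assertions are equivalent: (a) $\mathcal{L}_{\mathrm{id}}(L)$ is a Boolean lattice; (b) $\mathcal{L}_{\mathrm{id}}(L)$ is finite and complemented; (c) $\mathcal{L}_{\mathrm{id}}(L)$ is isomorphic to the $n$-cube for some $n\ge 0$; (d) the Jacobson radical of $L$ is zero and $\dim Z(L)\le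 1$; (e) $L=0$, or $L$ is one-dimensional, or $L$ is semisimple, or $L$ is the direct sum of a one-dimensional ideal $Fz$ and a semisimple ideal $S$. 3. Suppose that these conditions hold and let $L=S\oplus A$ with $S$ a semisimple ideal and $A$ an abelian ideal. Then the number $r$ of simple components of $S$ is finite ($r=0$ is possible), and either $A=0$ and $L$ has exactly $2^r$ ideals, or $\dim A=1$ and $L$ has exactly $2^{r+1}$ ideals. -/

import Mathlib

namespace LieIdealLattice

/-- A bounded lattice is Boolean if it is complemented and distributive. -/
def IsBooleanLattice (α : Type*) [Lattice α] [BoundedOrder α] : Prop :=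
  ComplementedLattice α ∧ ∀ a b c : α, a ⊓ (b ⊔ c) = (a ⊓ b) ⊔ (a ⊓ c)

/-- A lattice is an `n`-cube if it is isomorphic to the lattice of subsets of an `n`-element set. -/
def IsCube (α : Type*) [Lattice α] (n : ℕ) : Prop :=
  Nonempty (α ≃o Set (Fin n))

section

variable (F L : Type*) [Field F] [LieRing L] [LieAlgebra F L]

/-- A Lie algebra is semisimple if its solvable radical is zero (so `0` is semisimple). -/
def Semisimple : Prop := LieAlgebra.radical F L = ⊥

/-- The Jacobson radical: the intersection of all maximal ideals. -/
def jacobsonRadical : LieIdeal F L := sInf {I : LieIdeal F L | IsCoatom I}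

/-- The simple components of a semisimple Lie algebra are its simple ideals: the ideals which are
simple (in particular non-abelian) as Lie algebras. -/
def simpleComponents : Set (LieIdeal F L) := {I | LieAlgebra.IsSimple F I}

variable {F L}

/-- `L = S ⊕ A` as ideals, with `S` a semisimple ideal and `A` an abelian ideal. -/
def IsSemisimpleAbelianDecomp (S A : LieIdeal F L) : Prop :=
  Semisimple F S ∧ IsLieAbelian A ∧ IsCompl S A

end

end LieIdealLattice

/-!
The argument rests on a description of the ideals of `L = S ⊕ A` with `S` semisimple and `A`
abelian. By Cartan's criterion `S` has nondegenerate Killing form, so every ideal of `S` has a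
complement and `S` has no nonzero abelian ideals. If `I` is an ideal of `L` and `P` is its
projection to `S`, then `[P, P] ≤ I ∩ S`; hence `P` meets a complement of `I ∩ S` in an abelian
ideal of `S`, that is in zero, and `P = I ∩ S` (`projIdeal_le_comap`). So every ideal of `L` is the
sum of an ideal of `S` and a subspace of `A` (`idealsOrderIso`), and the ideal lattice is the
product of the lattice of sets of simple components of `S` and the lattice of subspaces of `A`
(`nonempty_orderIso_of_decomp`).

This product is always complemented. Since `F` is infinite, the second factor is distributive, or
finite, only when `dim A ≤ 1` (`finrank_le_one_of_distrib`, `finrank_le_one_of_finite_submodule`),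
and then it is a chain with one or two elements, so that the product is a finite cube.

Conversely, if the ideal lattice is complemented, a complement `A` of `S = [L, L]` is central and
`S` has no nonzero abelian ideals (`exists_decomp_of_complementedLattice`). Finally, the ideal
lattice is modular of finite length, so it is complemented exactly when its coatoms meet in zero,
that is when the Jacobson radical vanishes (`jacobsonRadical_eq_bot_iff`).
-/

namespace LieIdealLattice

/-! ### Ideals of a direct sum of two ideals -/

section DirectSum

variable {F L : Type*} [Field F] [LieRing L] [LieAlgebra F L] {S A : LieIdeal F L}

lemma exists_add_of_isCompl (h : IsCompl S A) (x : L) : ∃ s ∈ S, ∃ a ∈ A, s + a = x := by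
  rw [← LieSubmodule.mem_sup, h.sup_eq_top]
  exact LieSubmodule.mem_top x

lemma lie_eq_zero_of_disjoint (h : Disjoint S A) {s a : L} (hs : s ∈ S) (ha : a ∈ A) :
    ⁅s, a⁆ = 0 := by
  have hm : ⁅s, a⁆ ∈ S ⊓ A :=
    (LieSubmodule.mem_inf _ _ _).2 ⟨lie_mem_left F L S s a hs, lie_mem_right F L A s a ha⟩
  rwa [h.eq_bot, LieSubmodule.mem_bot] at hm

/-- An ideal of a direct summand `S` of `L`, regarded as an ideal of `L`. The complement of `S`
centralizes `S`, so no further brackets arise. -/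
def extendIdeal (h : IsCompl S A) (J : LieIdeal F S) : LieIdeal F L where
  __ := J.toSubmodule.map S.toSubmodule.subtype
  lie_mem := by
    rintro x _ ⟨y, hy, rfl⟩
    obtain ⟨s, hs, a, ha, rfl⟩ := exists_add_of_isCompl h x
    refine ⟨⁅(⟨s, hs⟩ : S), y⁆, lie_mem_right F S J _ _ hy, ?_⟩
    have h0 : ⁅a, (y : L)⁆ = 0 := lie_eq_zero_of_disjoint h.disjoint.symm ha y.2
    change ⁅s, (y : L)⁆ = ⁅s + a, (y : L)⁆
    rw [add_lie, h0, add_zero]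

lemma extendIdeal_mono (h : IsCompl S A) {J J' : LieIdeal F S} (hJ : J ≤ J') :
    extendIdeal h J ≤ extendIdeal h J' := by
  rintro _ ⟨y, hy, rfl⟩
  exact ⟨y, hJ hy, rfl⟩

/-- The projection to `S` of an ideal of `L = S ⊕ A`. -/
def projIdeal (h : IsCompl S A) (I : LieIdeal F L) : LieIdeal F S where
  carrier := {s | ∃ a ∈ A, (s : L) + a ∈ I}
  zero_mem' := ⟨0, A.zero_mem, by simp⟩
  add_mem' := by
    rintro s t ⟨a, ha, hs⟩ ⟨b, hb, ht⟩
    refine ⟨a + b, add_mem ha hb, ?_⟩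
    have := add_mem hs ht
    rwa [add_add_add_comm] at this
  smul_mem' := by
    rintro c s ⟨a, ha, hs⟩
    refine ⟨c • a, A.smul_mem c ha, ?_⟩
    have := I.smul_mem c hs
    rwa [smul_add] at this
  lie_mem := by
    rintro t s ⟨a, ha, hs⟩
    refine ⟨0, A.zero_mem, ?_⟩
    have h1 := lie_mem_right F L I (t : L) _ hs
    rw [lie_add, lie_eq_zero_of_disjoint h.disjoint t.2 ha] at h1
    exact h1

/-- A semisimple direct summand `S` absorbs projections: if `E` is a complement of `I ∩ S` in `S`,
then the part of the projection of `I` inside `E` is an abelian ideal of `S`, hence zero. -/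
lemma projIdeal_le_comap [CharZero F] [FiniteDimensional F L] (hS : Semisimple F S)
    (h : IsCompl S A) (I : LieIdeal F L) : projIdeal h I ≤ I.comap S.incl := by
  have : LieAlgebra.HasTrivialRadical F S := ⟨hS⟩
  have hlie : ⁅projIdeal h I, projIdeal h I⁆ ≤ I.comap S.incl := by
    rw [LieSubmodule.lie_le_iff]
    rintro s - t ⟨b, hb, ht⟩
    have h1 := lie_mem_right F L I (s : L) _ ht
    rw [lie_add, lie_eq_zero_of_disjoint h.disjoint s.2 hb, add_zero] at h1
    exact LieIdeal.mem_comap.2 h1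
  have hle : I.comap S.incl ≤ projIdeal h I := by
    intro s hs
    exact ⟨0, A.zero_mem, by simpa using hs⟩
  have hE := LieIdeal.isCompl_killingCompl (I.comap S.incl)
  set E := (I.comap S.incl).killingCompl
  have hab : IsLieAbelian (projIdeal h I ⊓ E : LieIdeal F S) := by
    rw [LieSubmodule.lie_abelian_iff_lie_self_eq_bot, ← le_bot_iff, ← hE.inf_eq_bot]
    exact le_inf ((LieSubmodule.mono_lie inf_le_left inf_le_left).trans hlie)
      ((LieSubmodule.lie_le_right _ _).trans inf_le_right)
  have hbot := (LieAlgebra.hasTrivialRadical_iff_no_abelian_ideals F S).1 inferInstance _ hab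
  refine (eq_of_le_of_inf_le_of_sup_le hle (z := E) ?_ ?_).ge
  · rw [hbot]
    exact bot_le
  · rw [hE.sup_eq_top]
    exact le_top

/-- If `L = S ⊕ A` with `S` semisimple, then every ideal of `L` is the sum of an ideal of `S` and
an ideal of `A`. -/
def idealsOrderIso [CharZero F] [FiniteDimensional F L] (hS : Semisimple F S)
    (h : IsCompl S A) : LieIdeal F L ≃o LieIdeal F S × LieIdeal F A :=
  Equiv.toOrderIso
    { toFun := fun I ↦ (I.comap S.incl, I.comap A.incl)
      invFun := fun p ↦ extendIdeal h p.1 ⊔ extendIdeal h.symm p.2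
      left_inv := by
        intro I
        apply le_antisymm
        · apply sup_le
          · rintro _ ⟨y, hy, rfl⟩
            exact hy
          · rintro _ ⟨y, hy, rfl⟩
            exact hy
        · intro x hx
          obtain ⟨s, hs, a, ha, rfl⟩ := exists_add_of_isCompl h x
          have hsI : s ∈ I := projIdeal_le_comap hS h I (x := ⟨s, hs⟩) ⟨a, ha, hx⟩
          have haI : a ∈ I := by simpa using sub_mem hx hsI
          exact (LieSubmodule.mem_sup _ _ _).2
            ⟨s, ⟨⟨s, hs⟩, hsI, rfl⟩, a, ⟨⟨a, ha⟩, haI, rfl⟩, rfl⟩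
      right_inv := by
        rintro ⟨J, K⟩
        have key : ∀ x : L, x ∈ extendIdeal h J ⊔ extendIdeal h.symm K →
            ∃ j ∈ J, ∃ k ∈ K, (j : L) + k = x := by
          intro x hx
          obtain ⟨_, ⟨j, hj, rfl⟩, _, ⟨k, hk, rfl⟩, rfl⟩ := (LieSubmodule.mem_sup _ _ _).1 hx
          exact ⟨j, hj, k, hk, rfl⟩
        have hzero : ∀ x : L, x ∈ S → x ∈ A → x = 0 := by
          intro x hxS hxA
          have hx := (LieSubmodule.mem_inf _ _ _).2 ⟨hxS, hxA⟩
          rwa [h.inf_eq_bot, LieSubmodule.mem_bot] at hx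
        refine Prod.ext (le_antisymm ?_ ?_) (le_antisymm ?_ ?_)
        · intro s hs
          obtain ⟨j, hj, k, hk, hjk⟩ := key _ (LieIdeal.mem_comap.1 hs)
          have hk0 : (k : L) = 0 := by
            refine hzero _ ?_ k.2
            rw [eq_sub_of_add_eq' hjk]
            exact sub_mem s.2 j.2
          rw [hk0, add_zero] at hjk
          rwa [← Subtype.ext hjk]
        · intro s hs
          exact LieIdeal.mem_comap.2 (LieSubmodule.mem_sup_left ⟨s, hs, rfl⟩)
        · intro a ha
          obtain ⟨j, hj, k, hk, hjk⟩ := key _ (LieIdeal.mem_comap.1 ha)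
          have hj0 : (j : L) = 0 := by
            refine hzero _ j.2 ?_
            rw [eq_sub_of_add_eq hjk]
            exact sub_mem a.2 k.2
          rw [hj0, zero_add] at hjk
          rwa [← Subtype.ext hjk]
        · intro a ha
          exact LieIdeal.mem_comap.2 (LieSubmodule.mem_sup_right ⟨a, ha, rfl⟩) }
    (fun _ _ hI ↦ ⟨LieIdeal.comap_mono hI, LieIdeal.comap_mono hI⟩)
    (fun _ _ hp ↦ sup_le_sup (extendIdeal_mono _ hp.1) (extendIdeal_mono _ hp.2))

end DirectSum

section Abelian

variable {F A : Type*} [Field F] [LieRing A] [LieAlgebra F A]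

/-- The ideals of an abelian Lie algebra are its subspaces. -/
def idealsOrderIsoSubmodule (hA : IsLieAbelian A) : LieIdeal F A ≃o Submodule F A where
  toFun I := I.toSubmodule
  invFun V :=
    { V with
      lie_mem := by
        intro x y _
        rw [trivial_lie_zero]
        exact V.zero_mem }
  left_inv _ := rfl
  right_inv _ := rfl
  map_rel_iff' := Iff.rfl

end Abelian

/-! ### Semisimple-plus-abelian decompositions -/

section Decomposition

variable {F L : Type*} [Field F] [LieRing L] [LieAlgebra F L] {S A : LieIdeal F L}

/-- The abelian summand commutes with both summands, and conversely the component of a central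
element in `S` lies in the centre of `S`, which is zero. -/
lemma eq_center_of_decomp (h : IsSemisimpleAbelianDecomp S A) : A = LieAlgebra.center F L := by
  obtain ⟨hS, hA, hSA⟩ := h
  apply le_antisymm
  · intro a ha
    rw [LieModule.mem_maxTrivSubmodule]
    intro x
    obtain ⟨s, hs, b, hb, rfl⟩ := exists_add_of_isCompl hSA x
    have hba : ⁅(⟨b, hb⟩ : A), (⟨a, ha⟩ : A)⁆ = 0 := trivial_lie_zero _ _ _ _
    have hba' : ⁅b, a⁆ = 0 := congrArg Subtype.val hba
    rw [add_lie, lie_eq_zero_of_disjoint hSA.disjoint hs ha, hba', add_zero]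
  · intro z hz
    rw [LieModule.mem_maxTrivSubmodule] at hz
    obtain ⟨s, hs, a, ha, rfl⟩ := exists_add_of_isCompl hSA z
    have hsc : (⟨s, hs⟩ : S) ∈ LieAlgebra.center F S := by
      rw [LieModule.mem_maxTrivSubmodule]
      intro t
      have h1 := hz t
      rw [lie_add, lie_eq_zero_of_disjoint hSA.disjoint t.2 ha, add_zero] at h1
      exact Subtype.ext h1
    have : LieAlgebra.HasTrivialRadical F S := ⟨hS⟩
    rw [LieAlgebra.center_eq_bot, LieSubmodule.mem_bot] at hsc
    have hs0 : s = 0 := congrArg Subtype.val hsc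
    rwa [hs0, zero_add]

/-- A complement of the derived ideal is central because its brackets with `L` lie in both
summands. An abelian ideal `I` of the derived ideal is an ideal of `L`; with a complement `J` of
`I`, the ideal `I` is central, so `[L, L] ≤ J` and `I = 0`. -/
lemma exists_decomp_of_complementedLattice [ComplementedLattice (LieIdeal F L)] :
    ∃ S A : LieIdeal F L, IsSemisimpleAbelianDecomp S A := by
  obtain ⟨A, hA⟩ := exists_isCompl ⁅(⊤ : LieIdeal F L), (⊤ : LieIdeal F L)⁆
  set D := ⁅(⊤ : LieIdeal F L), (⊤ : LieIdeal F L)⁆ with hD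
  have hmemD : ∀ x y : L, ⁅x, y⁆ ∈ D := fun x y ↦
    LieSubmodule.lie_mem_lie (LieSubmodule.mem_top x) (LieSubmodule.mem_top y)
  refine ⟨D, A, ?_, ?_, hA⟩
  · suffices LieAlgebra.HasTrivialRadical F D from this.radical_eq_bot
    rw [LieAlgebra.hasTrivialRadical_iff_no_abelian_ideals]
    intro I hI
    obtain ⟨J, hJ⟩ := exists_isCompl (extendIdeal hA I)
    have hcent : ∀ x : L, ∀ y ∈ extendIdeal hA I, ⁅x, y⁆ = 0 := by
      intro x y hy
      obtain ⟨i, hi, j, hj, rfl⟩ := exists_add_of_isCompl hJ x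
      rw [add_lie, lie_eq_zero_of_disjoint hJ.disjoint.symm hj hy, add_zero]
      obtain ⟨i, hi, rfl⟩ := hi
      obtain ⟨y, hy, rfl⟩ := hy
      have h0 : ⁅(⟨i, hi⟩ : I), (⟨y, hy⟩ : I)⁆ = 0 := trivial_lie_zero _ _ _ _
      exact congrArg (fun z : I ↦ ((z : D) : L)) h0
    have hDJ : D ≤ J := by
      rw [hD, LieSubmodule.lie_le_iff]
      rintro x - y -
      obtain ⟨i, hi, j, hj, rfl⟩ := exists_add_of_isCompl hJ y
      rw [lie_add, hcent x i hi, zero_add]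
      exact lie_mem_right F L J x j hj
    rw [LieSubmodule.eq_bot_iff]
    intro y hy
    have hyJ : (y : L) ∈ extendIdeal hA I ⊓ J :=
      (LieSubmodule.mem_inf _ _ _).2 ⟨⟨y, hy, rfl⟩, hDJ y.2⟩
    rw [hJ.inf_eq_bot, LieSubmodule.mem_bot] at hyJ
    exact Subtype.ext hyJ
  · refine ⟨fun x y ↦ Subtype.ext ?_⟩
    have hxy : ⁅(x : L), (y : L)⁆ ∈ D ⊓ A :=
      (LieSubmodule.mem_inf _ _ _).2 ⟨hmemD _ _, lie_mem_right F L A _ _ y.2⟩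
    rwa [hA.inf_eq_bot, LieSubmodule.mem_bot] at hxy

end Decomposition

/-! ### The ideals of a semisimple Lie algebra -/

section Semisimple

variable {F S : Type*} [Field F] [LieRing S] [LieAlgebra F S]

lemma simpleComponents_eq_setOf_isAtom [LieAlgebra.IsSemisimple F S] :
    simpleComponents F S = {I : LieIdeal F S | IsAtom I} := by
  ext I
  refine ⟨fun hI ↦ ?_, fun hI ↦ LieAlgebra.IsSemisimple.isSimple_of_isAtom I hI⟩
  have hI : LieAlgebra.IsSimple F I := hI
  have := LieAlgebra.IsSimple.nontrivial F (L := I)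
  refine ⟨(LieSubmodule.nontrivial_iff_ne_bot F S S).1 this, fun J hJ ↦ ?_⟩
  -- An ideal `J < I` of `S` restricts to an ideal of the simple Lie algebra `I`.
  rcases hI.eq_bot_or_eq_top (J.comap I.incl) with h | h
  · rw [LieIdeal.comap_incl_eq_bot] at h
    exact h.eq_bot_of_ge hJ.le
  · rw [LieIdeal.comap_incl_eq_top] at h
    exact absurd h hJ.not_ge

lemma finite_simpleComponents [FiniteDimensional F S] [LieAlgebra.IsSemisimple F S] :
    (simpleComponents F S).Finite := by
  rw [simpleComponents_eq_setOf_isAtom]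
  exact WellFoundedGT.finite_of_sSupIndep LieAlgebra.IsSemisimple.sSupIndep_isAtom

/-- Every ideal of a semisimple Lie algebra is the sum of a unique set of simple components. -/
lemma nonempty_orderIso_set_simpleComponents [LieAlgebra.IsSemisimple F S] :
    Nonempty (LieIdeal F S ≃o Set (simpleComponents F S)) := by
  rw [simpleComponents_eq_setOf_isAtom]
  have hB := LieAlgebra.IsSemisimple.booleanGenerators F S
  have hsub : ∀ T : Set {I : LieIdeal F S | IsAtom I},
      Subtype.val '' T ⊆ {I : LieIdeal F S | IsAtom I} := by
    rintro T _ ⟨I, -, rfl⟩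
    exact I.2
  let f : Set {I : LieIdeal F S | IsAtom I} ↪o LieIdeal F S :=
    OrderEmbedding.ofMapLEIff (fun T ↦ sSup (Subtype.val '' T)) fun T U ↦
      (hB.sSup_le_sSup_iff_of_atoms _ _ (hsub T) (hsub U)).trans
        (Set.image_subset_image_iff Subtype.val_injective)
  have hf : Function.Surjective f := by
    intro I
    obtain ⟨T, hT, hI⟩ := hB.atomistic I
      (by rw [LieAlgebra.IsSemisimple.sSup_atoms_eq_top]; exact le_top)
    refine ⟨Subtype.val ⁻¹' T, ?_⟩
    change sSup (Subtype.val '' (Subtype.val ⁻¹' T)) = I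
    rw [Subtype.image_preimage_coe, Set.inter_eq_right.2 hT, hI]
  exact ⟨(RelIso.ofSurjective f hf).symm⟩

lemma isSemisimple_of_semisimple [CharZero F] [FiniteDimensional F S] (hS : Semisimple F S) :
    LieAlgebra.IsSemisimple F S := by
  have : LieAlgebra.HasTrivialRadical F S := ⟨hS⟩
  infer_instance

end Semisimple

/-! ### Lattices of subspaces -/

section Subspaces

variable {F V : Type*} [Field F] [AddCommGroup V] [Module F V]

lemma exists_linearIndependent_pair (h : ¬ Module.finrank F V ≤ 1) :
    ∃ x y : V, LinearIndependent F ![x, y] := by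
  rw [not_le] at h
  have : Nontrivial V := Module.nontrivial_of_finrank_pos (R := F) (by omega)
  obtain ⟨x, hx⟩ := exists_ne (0 : V)
  exact ⟨x, exists_linearIndependent_pair_of_one_lt_finrank h hx⟩

/-- In a plane with basis `x, y`, the line through `x + y` lies in the sum of the lines through `x`
and `y` but meets each of them in zero. -/
lemma finrank_le_one_of_distrib
    (h : ∀ a b c : Submodule F V, a ⊓ (b ⊔ c) = (a ⊓ b) ⊔ (a ⊓ c)) :
    Module.finrank F V ≤ 1 := by
  by_contra hV
  obtain ⟨x, y, hxy⟩ := exists_linearIndependent_pair hV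
  rw [LinearIndependent.pair_iff] at hxy
  have hx : F ∙ (x + y) ⊓ F ∙ x = ⊥ := by
    rw [eq_bot_iff]
    rintro z ⟨hz, hz'⟩
    obtain ⟨c, rfl⟩ := Submodule.mem_span_singleton.1 hz
    obtain ⟨d, hd⟩ := Submodule.mem_span_singleton.1 hz'
    have hc := (hxy (c - d) c (by rw [sub_smul, hd, smul_add]; abel)).2
    simp [hc]
  have hy : F ∙ (x + y) ⊓ F ∙ y = ⊥ := by
    rw [eq_bot_iff]
    rintro z ⟨hz, hz'⟩
    obtain ⟨c, rfl⟩ := Submodule.mem_span_singleton.1 hz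
    obtain ⟨d, hd⟩ := Submodule.mem_span_singleton.1 hz'
    have hc := (hxy c (c - d) (by rw [sub_smul, hd, smul_add]; abel)).1
    simp [hc]
  have hmem : x + y ∈ F ∙ (x + y) ⊓ (F ∙ x ⊔ F ∙ y) :=
    ⟨Submodule.mem_span_singleton_self _,
      Submodule.add_mem_sup (Submodule.mem_span_singleton_self _)
        (Submodule.mem_span_singleton_self _)⟩
  rw [h, hx, hy, sup_bot_eq, Submodule.mem_bot] at hmem
  exact one_ne_zero (hxy 1 1 (by simpa using hmem)).1

/-- In a plane with basis `x, y`, the lines through `x + c y` are pairwise distinct. -/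
lemma finrank_le_one_of_finite_submodule [Infinite F] [Finite (Submodule F V)] :
    Module.finrank F V ≤ 1 := by
  by_contra hV
  obtain ⟨x, y, hxy⟩ := exists_linearIndependent_pair hV
  rw [LinearIndependent.pair_iff] at hxy
  refine not_injective_infinite_finite (fun c : F ↦ F ∙ (x + c • y)) fun c d hcd ↦ ?_
  have hmem : x + c • y ∈ F ∙ (x + d • y) := by
    rw [← show F ∙ (x + c • y) = F ∙ (x + d • y) from hcd]
    exact Submodule.mem_span_singleton_self _
  obtain ⟨t, ht⟩ := Submodule.mem_span_singleton.1 hmem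
  have h0 : (t - 1) • x + (t * d - c) • y = 0 := by
    rw [sub_smul, sub_smul, mul_smul, one_smul, ← sub_eq_zero.2 ht, smul_add]
    abel
  obtain ⟨h1, h2⟩ := hxy _ _ h0
  rw [sub_eq_zero.1 h1, one_mul] at h2
  exact (sub_eq_zero.1 h2).symm

lemma card_submodule_of_finrank_eq_one (h : Module.finrank F V = 1) :
    Nat.card (Submodule F V) = 2 := by
  have : IsSimpleModule F V := isSimpleModule_iff_finrank_eq_one.2 h
  classical
  rw [Nat.card_congr IsSimpleOrder.equivBool]
  simp

lemma nonempty_submodule_orderIso_set [FiniteDimensional F V] (h : Module.finrank F V ≤ 1) :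
    Nonempty (Submodule F V ≃o Set (Fin (Module.finrank F V))) := by
  rcases Nat.le_one_iff_eq_zero_or_eq_one.1 h with h0 | h1
  · have : Subsingleton V := Module.finrank_zero_iff.1 h0
    rw [h0]
    exact ⟨OrderIso.ofUnique _ _⟩
  · have : IsSimpleModule F V := isSimpleModule_iff_finrank_eq_one.2 h1
    rw [h1]
    have : IsSimpleOrder (Set (Fin 1)) :=
      ⟨fun s ↦ s.eq_empty_or_nonempty.imp id Subsingleton.eq_univ_of_nonempty⟩
    classical
    exact ⟨IsSimpleOrder.orderIsoBool.trans IsSimpleOrder.orderIsoBool.symm⟩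

end Subspaces

/-! ### Complemented and Boolean lattices -/

/-- The product of two order isomorphisms. -/
def prodOrderIso {α β γ δ : Type*} [Preorder α] [Preorder β] [Preorder γ] [Preorder δ]
    (e : α ≃o β) (f : γ ≃o δ) : α × γ ≃o β × δ where
  __ := e.toEquiv.prodCongr f.toEquiv
  map_rel_iff' := and_congr e.le_iff_le f.le_iff_le

section Lattice

variable {α : Type*} [Lattice α] [BoundedOrder α]

lemma isBooleanLattice_of_isCube {n : ℕ} (h : IsCube α n) : IsBooleanLattice α := by
  obtain ⟨e⟩ := h
  refine ⟨e.complementedLattice_iff.2 inferInstance, fun a b c ↦ e.injective ?_⟩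
  simp only [map_inf, map_sup, inf_sup_left]

lemma finite_of_isCube {α : Type*} [Lattice α] {n : ℕ} (h : IsCube α n) : Finite α := by
  obtain ⟨e⟩ := h
  exact Finite.of_equiv _ e.symm.toEquiv

/-- The order dual of an Artinian lattice is compactly generated, so this is the dual of the fact
that a compactly generated modular lattice is complemented if and only if `⊤` is a join of
atoms. -/
lemma sInf_coatoms_eq_bot_iff {β : Type*} [CompleteLattice β] [IsModularLattice β]
    [WellFoundedLT β] : sInf {a : β | IsCoatom a} = ⊥ ↔ ComplementedLattice β := by
  have : IsCompactlyGenerated βᵒᵈ := CompleteLattice.isCompactlyGenerated_of_wellFoundedGT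
  have hset : OrderDual.toDual (sInf {a : β | IsCoatom a}) = sSup {a : βᵒᵈ | IsAtom a} := by
    rw [toDual_sInf]
    congr 1
  constructor
  · intro h
    have : ComplementedLattice βᵒᵈ := by
      refine complementedLattice_of_sSup_atoms_eq_top ?_
      rw [← hset, h]
      rfl
    exact (OrderIso.dualDual β).complementedLattice_iff.2 inferInstance
  · intro h
    have htop : sSup {a : βᵒᵈ | IsAtom a} = ⊤ := sSup_atoms_eq_top
    rw [← hset] at htop
    exact congrArg OrderDual.ofDual htop

end Lattice

lemma jacobsonRadical_eq_bot_iff {F L : Type*} [Field F] [LieRing L] [LieAlgebra F L]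
    [FiniteDimensional F L] :
    jacobsonRadical F L = ⊥ ↔ ComplementedLattice (LieIdeal F L) := by
  have : WellFoundedLT (LieIdeal F L) := LieSubmodule.wellFoundedLT_of_isArtinian F L L
  exact sInf_coatoms_eq_bot_iff

/-! ### Ideals of semisimple-plus-abelian Lie algebras -/

section Decomposed

variable {F L : Type*} [Field F] [CharZero F] [LieRing L] [LieAlgebra F L]
  [FiniteDimensional F L] {S A : LieIdeal F L}

/-- The ideals of `L = S ⊕ A` correspond to pairs of a set of simple components of `S` and a
subspace of `A`. -/
lemma nonempty_orderIso_of_decomp (h : IsSemisimpleAbelianDecomp S A) :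
    Nonempty (LieIdeal F L ≃o Set (simpleComponents F S) × Submodule F A) := by
  obtain ⟨hS, hA, hSA⟩ := h
  have := isSemisimple_of_semisimple hS
  obtain ⟨e⟩ := nonempty_orderIso_set_simpleComponents (F := F) (S := S)
  exact ⟨(idealsOrderIso hS hSA).trans (prodOrderIso e (idealsOrderIsoSubmodule hA))⟩

lemma complementedLattice_of_decomp (h : IsSemisimpleAbelianDecomp S A) :
    ComplementedLattice (LieIdeal F L) := by
  obtain ⟨e⟩ := nonempty_orderIso_of_decomp h
  refine e.complementedLattice_iff.2 ⟨fun ⟨T, V⟩ ↦ ?_⟩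
  obtain ⟨T', hT⟩ := exists_isCompl T
  obtain ⟨V', hV⟩ := exists_isCompl V
  exact ⟨(T', V'), Prod.isCompl_iff.2 ⟨hT, hV⟩⟩

/-- The second factor of `LieIdeal F L ≃o Set _ × Submodule F A` inherits distributivity. -/
lemma finrank_le_one_of_isBooleanLattice (h : IsSemisimpleAbelianDecomp S A)
    (hB : IsBooleanLattice (LieIdeal F L)) : Module.finrank F A ≤ 1 := by
  obtain ⟨e⟩ := nonempty_orderIso_of_decomp h
  refine finrank_le_one_of_distrib fun a b c ↦ ?_
  have habc := congrArg e (hB.2 (e.symm (⊥, a)) (e.symm (⊥, b)) (e.symm (⊥, c)))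
  simp only [map_inf, map_sup, OrderIso.apply_symm_apply] at habc
  exact congrArg Prod.snd habc

lemma finrank_le_one_of_finite (h : IsSemisimpleAbelianDecomp S A) [Finite (LieIdeal F L)] :
    Module.finrank F A ≤ 1 := by
  obtain ⟨e⟩ := nonempty_orderIso_of_decomp h
  have : Finite (Submodule F A) :=
    Finite.of_injective (fun V ↦ e.symm (⊥, V)) fun V W hVW ↦
      congrArg Prod.snd (e.symm.injective hVW)
  exact finrank_le_one_of_finite_submodule

lemma exists_isCube_of_decomp (h : IsSemisimpleAbelianDecomp S A)
    (hA : Module.finrank F A ≤ 1) : ∃ n, IsCube (LieIdeal F L) n := by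
  obtain ⟨e⟩ := nonempty_orderIso_of_decomp h
  obtain ⟨f⟩ := nonempty_submodule_orderIso_set hA
  have := isSemisimple_of_semisimple h.1
  have := (finite_simpleComponents (F := F) (S := S)).to_subtype
  obtain ⟨n, ⟨g⟩⟩ := Finite.exists_equiv_fin (simpleComponents F S ⊕ Fin (Module.finrank F A))
  let g' : Set (simpleComponents F S ⊕ Fin (Module.finrank F A)) ≃o Set (Fin n) :=
    { Equiv.Set.congr g with
      map_rel_iff' := Set.image_subset_image_iff g.injective }
  exact ⟨n, ⟨(e.trans (prodOrderIso (OrderIso.refl _) f)).trans (Set.sumEquiv.symm.trans g')⟩⟩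

/-- The listed shapes of `L` are those of a decomposition `S ⊕ A` with `dim A ≤ 1`: `L = A` when
`L` is at most one-dimensional, and `A = 0` when `L` is semisimple. -/
lemma exists_decomp_finrank_le_one_iff :
    (∃ S A : LieIdeal F L, IsSemisimpleAbelianDecomp S A ∧ Module.finrank F A ≤ 1) ↔
      (Subsingleton L ∨ Module.finrank F L = 1 ∨ Semisimple F L ∨
        ∃ I S : LieIdeal F L, Module.finrank F I = 1 ∧ Semisimple F S ∧ IsCompl I S) := by
  have hab : ∀ (M : Type _) [LieRing M] [LieAlgebra F M], Module.finrank F M = 1 →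
      IsLieAbelian M := by
    intro M _ _ hM
    obtain ⟨v, -, hv⟩ := finrank_eq_one_iff'.1 hM
    refine ⟨fun x y ↦ ?_⟩
    obtain ⟨c, rfl⟩ := hv x
    obtain ⟨d, rfl⟩ := hv y
    simp
  have hbot : Semisimple F (⊥ : LieIdeal F L) :=
    LieAlgebra.HasTrivialRadical.radical_eq_bot
  constructor
  · rintro ⟨S, A, ⟨hS, -, hSA⟩, hA⟩
    rcases Nat.le_one_iff_eq_zero_or_eq_one.1 hA with h0 | h1
    · have : Subsingleton A := Module.finrank_zero_iff.1 h0
      have hAbot : A = ⊥ := by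
        rw [LieSubmodule.eq_bot_iff]
        intro x hx
        exact congrArg Subtype.val (Subsingleton.elim (⟨x, hx⟩ : A) 0)
      subst hAbot
      obtain rfl : S = ⊤ := by simpa using hSA.sup_eq_top
      refine Or.inr (Or.inr (Or.inl ?_))
      suffices LieAlgebra.HasTrivialRadical F L from this.radical_eq_bot
      have : LieAlgebra.HasTrivialRadical F (⊤ : LieIdeal F L) := ⟨hS⟩
      have := LieAlgebra.isKilling_of_equiv (LieIdeal.topEquiv (R := F) (L := L))
      infer_instance
    · exact Or.inr (Or.inr (Or.inr ⟨A, S, h1, hS, hSA.symm⟩))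
  · rintro (hL | hL | hL | ⟨I, S, hI, hS, hIS⟩)
    · refine ⟨⊥, ⊤, ⟨hbot, ⟨fun x y ↦ Subsingleton.elim _ _⟩, isCompl_bot_top⟩, ?_⟩
      exact (LinearEquiv.finrank_eq (LieIdeal.topEquiv (R := F) (L := L)).toLinearEquiv).trans_le
        (by simp [Module.finrank_zero_of_subsingleton])
    · have htop : Module.finrank F (⊤ : LieIdeal F L) = 1 :=
        (LinearEquiv.finrank_eq (LieIdeal.topEquiv (R := F) (L := L)).toLinearEquiv).trans hL
      exact ⟨⊥, ⊤, ⟨hbot, hab _ htop, isCompl_bot_top⟩, htop.le⟩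
    · refine ⟨⊤, ⊥, ⟨?_, ⟨fun x y ↦ Subsingleton.elim _ _⟩, isCompl_top_bot⟩, ?_⟩
      · suffices LieAlgebra.HasTrivialRadical F (⊤ : LieIdeal F L) from this.radical_eq_bot
        have : LieAlgebra.HasTrivialRadical F L := ⟨hL⟩
        have := LieAlgebra.isKilling_of_equiv (LieIdeal.topEquiv (R := F) (L := L)).symm
        infer_instance
      · exact (Module.finrank_zero_of_subsingleton (R := F) (M := (⊥ : LieIdeal F L))).trans_le
          zero_le_one
    · exact ⟨S, I, ⟨hS, hab _ hI, hIS.symm⟩, hI.le⟩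

lemma card_ideals_of_decomp (h : IsSemisimpleAbelianDecomp S A) (hA : Module.finrank F A ≤ 1) :
    (simpleComponents F S).Finite ∧
      ((A = ⊥ ∧ Nat.card (LieIdeal F L) = 2 ^ (simpleComponents F S).ncard) ∨
        (Module.finrank F A = 1 ∧
          Nat.card (LieIdeal F L) = 2 ^ ((simpleComponents F S).ncard + 1))) := by
  have := isSemisimple_of_semisimple h.1
  have hfin := finite_simpleComponents (F := F) (S := S)
  have := hfin.to_subtype
  have hset : Nat.card (Set (simpleComponents F S)) = 2 ^ (simpleComponents F S).ncard := by
    have := Fintype.ofFinite (simpleComponents F S)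
    rw [Nat.card_eq_fintype_card, Fintype.card_set, ← Nat.card_eq_fintype_card,
      Nat.card_coe_set_eq]
  obtain ⟨e⟩ := nonempty_orderIso_of_decomp h
  refine ⟨hfin, ?_⟩
  rw [Nat.card_congr e.toEquiv, Nat.card_prod, hset]
  rcases Nat.le_one_iff_eq_zero_or_eq_one.1 hA with h0 | h1
  · have : Subsingleton A := Module.finrank_zero_iff.1 h0
    refine Or.inl ⟨?_, by rw [Nat.card_unique, mul_one]⟩
    rw [LieSubmodule.eq_bot_iff]
    intro x hx
    exact congrArg Subtype.val (Subsingleton.elim (⟨x, hx⟩ : A) 0)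
  · exact Or.inr ⟨h1, by rw [card_submodule_of_finrank_eq_one h1, pow_succ]⟩

end Decomposed

end LieIdealLattice

open LieIdealLattice in
theorem mainTheorem3 (F L : Type*) [Field F] [CharZero F] [LieRing L] [LieAlgebra F L]
    [FiniteDimensional F L] :
    -- complemented ideal lattices
    (ComplementedLattice (LieIdeal F L) ↔
      ∃ S A : LieIdeal F L, IsSemisimpleAbelianDecomp S A) ∧
    (∀ S A : LieIdeal F L, IsSemisimpleAbelianDecomp S A → A = LieAlgebra.center F L) ∧
    -- the five equivalent conditions
    List.TFAE
      [ IsBooleanLattice (LieIdeal F L),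
        Finite (LieIdeal F L) ∧ ComplementedLattice (LieIdeal F L),
        ∃ n : ℕ, IsCube (LieIdeal F L) n,
        jacobsonRadical F L = ⊥ ∧ Module.finrank F (LieAlgebra.center F L) ≤ 1,
        Subsingleton L ∨ Module.finrank F L = 1 ∨ Semisimple F L ∨
          ∃ I S : LieIdeal F L, Module.finrank F I = 1 ∧ Semisimple F S ∧ IsCompl I S ] ∧
    -- the number of ideals
    (IsBooleanLattice (LieIdeal F L) →
      ∀ S A : LieIdeal F L, IsSemisimpleAbelianDecomp S A →
        (simpleComponents F S).Finite ∧
        ((A = ⊥ ∧ Nat.card (LieIdeal F L) = 2 ^ (simpleComponents F S).ncard) ∨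
          (Module.finrank F A = 1 ∧
            Nat.card (LieIdeal F L) = 2 ^ ((simpleComponents F S).ncard + 1)))) := by
  have hcompl : ComplementedLattice (LieIdeal F L) ↔
      ∃ S A : LieIdeal F L, IsSemisimpleAbelianDecomp S A :=
    ⟨fun _ ↦ exists_decomp_of_complementedLattice,
      fun ⟨_, _, h⟩ ↦ complementedLattice_of_decomp h⟩
  refine ⟨hcompl, fun _ _ h ↦ eq_center_of_decomp h, ?_, fun hB _ _ h ↦
    card_ideals_of_decomp h (finrank_le_one_of_isBooleanLattice h hB)⟩
  rw [← exists_decomp_finrank_le_one_iff]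
  tfae_have 1 → 5 := fun hB ↦ by
    obtain ⟨S, A, h⟩ := hcompl.1 hB.1
    exact ⟨S, A, h, finrank_le_one_of_isBooleanLattice h hB⟩
  tfae_have 2 → 5 := fun ⟨_, hC⟩ ↦ by
    obtain ⟨S, A, h⟩ := hcompl.1 hC
    exact ⟨S, A, h, finrank_le_one_of_finite h⟩
  tfae_have 5 → 3 := fun ⟨_, _, h, hA⟩ ↦ exists_isCube_of_decomp h hA
  tfae_have 3 → 1 := fun ⟨_, hn⟩ ↦ isBooleanLattice_of_isCube hn
  tfae_have 3 → 2 := fun ⟨_, hn⟩ ↦ ⟨finite_of_isCube hn, (isBooleanLattice_of_isCube hn).1⟩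
  tfae_have 4 → 5 := fun ⟨hJ, hZ⟩ ↦ by
    obtain ⟨S, A, h⟩ := hcompl.1 (jacobsonRadical_eq_bot_iff.1 hJ)
    rw [← eq_center_of_decomp h] at hZ
    exact ⟨S, A, h, hZ⟩
  tfae_have 5 → 4 := fun ⟨S, A, h, hA⟩ ↦ by
    refine ⟨jacobsonRadical_eq_bot_iff.2 (hcompl.2 ⟨S, A, h⟩), ?_⟩
    rwa [← eq_center_of_decomp h]
  tfae_finish
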